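/- Let $n \ge 3$ be an integer and let $\Sigma \subset \mathbb{R}^{n+1}$ be a nonempty closed (that is, compact, without boundary), smoothly embedded $n$-dimensional hypersurface that is convex, meaning that $\Sigma$ is the boundary of an open convex subset of $\mathbb{R}^{n+1}$. Let $g$ be the Riemannian metric on $\Sigma$ induced by the flat metric of $\mathbb{R}^{n+1}$, and let $\mathrm{Ric}$ be the Ricci tensor of $g$ (with the sign for which round spheres have positive Ricci curvature). If $$\mathrm{Ric} = (n-1)\, g$$ at every point of $\Sigma$, then $(\Sigma, g)$ is isometric to the round unit sphere $\mathbb{S}^n \subset \mathbb{R}^{n+1}$ with its standard metric $\sigma$: there is a smooth diffeomorphism $F : \Sigma \to \mathbb{S}^n$ with $F^*\sigma = g$. -/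

import Mathlib

open scoped Manifold ContDiff

noncomputable section

namespace HypersurfaceRigidity

/-- The Euclidean space `ℝᵈ` with its standard inner product. -/
abbrev Eucl (d : ℕ) := EuclideanSpace ℝ (Fin d)

/-- A field of bilinear forms on the tangent spaces of an `n`-dimensional manifold. -/
abbrev BilinField (n : ℕ) (M : Type*) [TopologicalSpace M] [ChartedSpace (Eucl n) M] :=
  ∀ x : M, LinearMap.BilinForm ℝ (TangentSpace (𝓡 n) x)

/-- The metric induced by a map `f : M → ℝᵈ`: the pullback `f^* ⟨·,·⟩` of the flat metric,
`(v, w) ↦ ⟨df_x v, df_x w⟩`. -/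
def inducedMetric {n d : ℕ} {M : Type*} [TopologicalSpace M] [ChartedSpace (Eucl n) M]
    (f : M → Eucl d) : BilinField n M := fun x =>
  let df : TangentSpace (𝓡 n) x →L[ℝ] Eucl d := mfderiv (𝓡 n) (𝓡 d) f x
  (innerₗ (Eucl d)).compl₁₂ df.toLinearMap df.toLinearMap

section Coordinates

variable {n : ℕ}

/-- The partial derivative `∂ᵢ u` at `y`. -/
def pderiv (i : Fin n) (u : Eucl n → ℝ) (y : Eucl n) : ℝ :=
  fderiv ℝ u y (EuclideanSpace.single i 1)

/-- The Christoffel symbols `Γᵏᵢⱼ = ½ ∑ₗ gᵏˡ (∂ᵢ gⱼₗ + ∂ⱼ gᵢₗ - ∂ₗ gᵢⱼ)` of a metric with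
coefficient matrix `G` in coordinates. -/
def christoffel (G : Eucl n → Matrix (Fin n) (Fin n) ℝ) (k i j : Fin n) (y : Eucl n) : ℝ :=
  (1 / 2) * ∑ l, (G y)⁻¹ k l *
    (pderiv i (fun z => G z j l) y + pderiv j (fun z => G z i l) y
      - pderiv l (fun z => G z i j) y)

/-- The components `R_{ijk}^l` of the Riemann tensor, `R(∂ᵢ, ∂ⱼ)∂ₖ = ∑ₗ R_{ijk}^l ∂ₗ`, with the
sign convention `R(X, Y)Z = ∇²_{Y,X} Z - ∇²_{X,Y} Z`. -/
def riemannCoord (G : Eucl n → Matrix (Fin n) (Fin n) ℝ) (i j k l : Fin n) (y : Eucl n) : ℝ :=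
  pderiv j (christoffel G l i k) y - pderiv i (christoffel G l j k) y
    + ∑ m, (christoffel G m i k y * christoffel G l j m y
        - christoffel G m j k y * christoffel G l i m y)

/-- The components of the Ricci tensor `Ricᵢⱼ = g^{pq} Riem_{ipjq} = ∑ₚ R_{ipj}^p`; with this
convention the Ricci tensor of a round sphere is positive. -/
def ricciCoord (G : Eucl n → Matrix (Fin n) (Fin n) ℝ) (i j : Fin n) (y : Eucl n) : ℝ :=
  ∑ p, riemannCoord G i p j p y

end Coordinates

section Manifold

variable {n : ℕ} {M : Type*} [TopologicalSpace M] [ChartedSpace (Eucl n) M]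

/-- The coefficients `gᵢⱼ(y) = g(∂ᵢ, ∂ⱼ)` of `g` in the chart around `x₀`, as functions on
the target of that chart. -/
def metricCoord (g : BilinField n M) (x₀ : M) (y : Eucl n) : Matrix (Fin n) (Fin n) ℝ :=
  Matrix.of fun i j =>
    g ((extChartAt (𝓡 n) x₀).symm y)
      (mfderiv (𝓡 n) (𝓡 n) (extChartAt (𝓡 n) x₀).symm y (EuclideanSpace.single i (1 : ℝ)))
      (mfderiv (𝓡 n) (𝓡 n) (extChartAt (𝓡 n) x₀).symm y (EuclideanSpace.single j (1 : ℝ)))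

/-- The Ricci tensor of `g` at `x` on the tangent vectors `v` and `w`, computed in the chart
around `x`. The components of `v` are those of its image under the differential of the chart. -/
def ricci (g : BilinField n M) (x : M) (v w : TangentSpace (𝓡 n) x) : ℝ :=
  let e := extChartAt (𝓡 n) x
  let v' : Eucl n := mfderiv (𝓡 n) (𝓡 n) e x v
  let w' : Eucl n := mfderiv (𝓡 n) (𝓡 n) e x w
  ∑ i, ∑ j, ricciCoord (metricCoord g x) i j (e x) * v' i * w' j

/-- `(M, g)` and `(N, h)` are isometric: there is a smooth diffeomorphism `F` with
`F^* h = g`. -/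
def RiemannianIsometric {N : Type*} [TopologicalSpace N] [ChartedSpace (Eucl n) N]
    (g : BilinField n M) (h : BilinField n N) : Prop :=
  ∃ F : M ≃ₘ^∞⟮𝓡 n, 𝓡 n⟯ N, ∀ (x : M) (v w : TangentSpace (𝓡 n) x),
    h (F x) (mfderiv (𝓡 n) (𝓡 n) F x v) (mfderiv (𝓡 n) (𝓡 n) F x w) = g x v w

end Manifold

/-- A subset of `ℝᵈ` is a convex hypersurface if it is the boundary of an open, convex set. -/
def IsConvexBoundary {d : ℕ} (S : Set (Eucl d)) : Prop :=
  ∃ Ω : Set (Eucl d), IsOpen Ω ∧ Convex ℝ Ω ∧ frontier Ω = S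

/-- The unit sphere `𝕊ⁿ` in `ℝⁿ⁺¹`. -/
abbrev unitSphere (n : ℕ) : Set (Eucl (n + 1)) := Metric.sphere 0 1

end HypersurfaceRigidity

end

open HypersurfaceRigidity

/-! By the Gauss equation, the principal curvatures `λᵢ` of the hypersurface satisfy `H λᵢ - λᵢ² = n
- 1`, where `H = ∑ λᵢ`. Two distinct ones would be the two roots of one quadratic and so add up to
`H`. The remaining ones, which exist as `n ≥ 3`, would sum to zero, although each has `H λₖ > 0`.
Hence all `λᵢ` equal one `s = ±1`: the hypersurface is umbilic (`IsParam.ricciCoord_eq`,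
`eq_smul_of_trace_smul_sub`).

With unit normal `ν`, the point `c = X + s ν` is the centre of a unit sphere with second-order
contact. It does not depend on the sign of `ν`, so no orientation is needed, and its derivative
vanishes (`IsParam.hasFDerivAt_osculatingCenter`). The second-order contact condition does not
depend on the chart, so `c` is a locally constant function on the hypersurface.

Convexity enters only globally. The convex set is bounded, so its boundary is connected and `c` is
constant. A convex open set with nonempty boundary inside a sphere is the ball
(`frontier_eq_sphere_of_subset`), so the hypersurface is a full unit sphere, and a translation is
the isometry. -/

namespace HypersurfaceRigidity

/-! ### Partial derivatives of vector-valued maps and smoothness of matrix inverses. -/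

section Calculus

variable {n : ℕ} {V : Type*} [NormedAddCommGroup V] [InnerProductSpace ℝ V]

/-- The partial derivative `∂ᵢ X` of a vector-valued map. -/
noncomputable def dirDeriv (i : Fin n) (X : Eucl n → V) (y : Eucl n) : V :=
  fderiv ℝ X y (EuclideanSpace.single i 1)

lemma pderiv_eq_dirDeriv (i : Fin n) (u : Eucl n → ℝ) : pderiv i u = dirDeriv i u := rfl

lemma ContDiffAt.dirDeriv {X : Eucl n → V} {y : Eucl n} (h : ContDiffAt ℝ ∞ X y) (i : Fin n) :
    ContDiffAt ℝ ∞ (dirDeriv i X) y :=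
  (h.fderiv_right (m := ∞) (by simp)).clm_apply contDiffAt_const

lemma ContDiffAt.pderiv {u : Eucl n → ℝ} {y : Eucl n} (h : ContDiffAt ℝ ∞ u y) (i : Fin n) :
    ContDiffAt ℝ ∞ (pderiv i u) y := ContDiffAt.dirDeriv h i

lemma ContDiffAt.differentiableAt_top {X : Eucl n → V} {y : Eucl n} (h : ContDiffAt ℝ ∞ X y) :
    DifferentiableAt ℝ X y := h.differentiableAt (by simp)

lemma dirDeriv_comm {X : Eucl n → V} {y : Eucl n} (h : ContDiffAt ℝ ∞ X y) (i j : Fin n) :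
    dirDeriv i (dirDeriv j X) y = dirDeriv j (dirDeriv i X) y := by
  have hs := h.isSymmSndFDerivAt
    (by rw [minSmoothness_of_isRCLikeNormedField]; exact WithTop.coe_le_coe.2 le_top)
  have hd : DifferentiableAt ℝ (fderiv ℝ X) y :=
    (h.fderiv_right (m := ∞) (by simp)).differentiableAt (by simp)
  have key (a b : Fin n) : dirDeriv a (dirDeriv b X) y
      = fderiv ℝ (fderiv ℝ X) y (EuclideanSpace.single a 1) (EuclideanSpace.single b 1) := by
    change fderiv ℝ (fun z => fderiv ℝ X z (EuclideanSpace.single b 1)) y _ = _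
    rw [fderiv_clm_apply hd (differentiableAt_const _)]
    simp
  rw [key, key, hs.eq]

lemma dirDeriv_congr {X Y : Eucl n → V} {U : Set (Eucl n)} (hU : IsOpen U) {y : Eucl n}
    (hy : y ∈ U) (h : ∀ z ∈ U, X z = Y z) (i : Fin n) : dirDeriv i X y = dirDeriv i Y y := by
  unfold dirDeriv
  rw [Filter.EventuallyEq.fderiv_eq (Filter.eventually_of_mem (hU.mem_nhds hy) h)]

lemma dirDeriv_inner {a b : Eucl n → V} {y : Eucl n} (ha : DifferentiableAt ℝ a y)
    (hb : DifferentiableAt ℝ b y) (i : Fin n) :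
    dirDeriv i (fun z => inner ℝ (a z) (b z)) y
      = inner ℝ (a y) (dirDeriv i b y) + inner ℝ (dirDeriv i a y) (b y) := by
  unfold dirDeriv
  rw [fderiv_inner_apply ℝ ha hb]

lemma dirDeriv_mul {a b : Eucl n → ℝ} {y : Eucl n} (ha : DifferentiableAt ℝ a y)
    (hb : DifferentiableAt ℝ b y) (i : Fin n) :
    dirDeriv i (fun z => a z * b z) y = a y * dirDeriv i b y + b y * dirDeriv i a y := by
  unfold dirDeriv
  rw [fderiv_fun_mul ha hb]
  simp

lemma dirDeriv_sub {a b : Eucl n → V} {y : Eucl n} (ha : DifferentiableAt ℝ a y)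
    (hb : DifferentiableAt ℝ b y) (i : Fin n) :
    dirDeriv i (fun z => a z - b z) y = dirDeriv i a y - dirDeriv i b y := by
  unfold dirDeriv
  rw [fderiv_fun_sub ha hb]
  simp

lemma dirDeriv_sum {ι : Type*} {s : Finset ι} {a : ι → Eucl n → V} {y : Eucl n}
    (ha : ∀ k ∈ s, DifferentiableAt ℝ (a k) y) (i : Fin n) :
    dirDeriv i (fun z => ∑ k ∈ s, a k z) y = ∑ k ∈ s, dirDeriv i (a k) y := by
  unfold dirDeriv
  rw [fderiv_fun_sum ha]
  simp

lemma ContDiffAt.matrix_det {m : Type*} [Fintype m] [DecidableEq m]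
    {A : Eucl n → Matrix m m ℝ} {y : Eucl n} (h : ∀ i j, ContDiffAt ℝ ∞ (fun z => A z i j) y) :
    ContDiffAt ℝ ∞ (fun z => (A z).det) y := by
  simp_rw [Matrix.det_apply']
  exact ContDiffAt.sum fun σ _ => contDiffAt_const.mul (contDiffAt_prod fun i _ => h _ _)

lemma ContDiffAt.matrix_inv {m : Type*} [Fintype m] [DecidableEq m]
    {A : Eucl n → Matrix m m ℝ} {y : Eucl n} (h : ∀ i j, ContDiffAt ℝ ∞ (fun z => A z i j) y)
    (hy : (A y).det ≠ 0) (i j : m) :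
    ContDiffAt ℝ ∞ (fun z => (A z)⁻¹ i j) y := by
  simp_rw [Matrix.inv_def, Matrix.smul_apply, Ring.inverse_eq_inv', smul_eq_mul]
  refine ((ContDiffAt.matrix_det h).inv hy).mul ?_
  simp_rw [Matrix.adjugate_apply]
  refine ContDiffAt.matrix_det fun a b => ?_
  simp_rw [Matrix.updateRow_apply]
  split_ifs
  · exact contDiffAt_const
  · exact h _ _

end Calculus

/-! ### The Gauss equation for a parametrized submanifold. -/

section Gauss

variable {n : ℕ} {V : Type*} [NormedAddCommGroup V] [InnerProductSpace ℝ V]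

/-- A smooth parametrization `X` of an immersed piece of `V` over the open set `U`, with `G` the
matrix of its first fundamental form. -/
structure IsParam (X : Eucl n → V) (U : Set (Eucl n)) (G : Eucl n → Matrix (Fin n) (Fin n) ℝ) :
    Prop where
  isOpen : IsOpen U
  contDiffAt : ∀ z ∈ U, ContDiffAt ℝ ∞ X z
  gram : ∀ z ∈ U, ∀ i j, G z i j = inner ℝ (dirDeriv i X z) (dirDeriv j X z)
  linearIndependent : ∀ z ∈ U, LinearIndependent ℝ fun i => dirDeriv i X z

namespace IsParam

variable {X : Eucl n → V} {U : Set (Eucl n)} {G : Eucl n → Matrix (Fin n) (Fin n) ℝ}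
  {y : Eucl n}

lemma contDiffAt_gram (P : IsParam X U G) (hy : y ∈ U) (i j : Fin n) : ContDiffAt ℝ ∞ (fun z => G z i j) y := by
  have hX := P.contDiffAt y hy
  refine ((hX.dirDeriv i).inner ℝ (hX.dirDeriv j)).congr_of_eventuallyEq ?_
  exact Filter.eventually_of_mem (P.isOpen.mem_nhds hy) fun z hz => P.gram z hz i j

lemma gram_eq (P : IsParam X U G) (hy : y ∈ U) : G y = Matrix.gram ℝ fun i => dirDeriv i X y := by
  ext i j; exact P.gram y hy i j

lemma posDef (P : IsParam X U G) (hy : y ∈ U) : (G y).PosDef := by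
  rw [P.gram_eq hy]
  exact Matrix.posDef_gram_of_linearIndependent (P.linearIndependent y hy)

lemma det_ne_zero (P : IsParam X U G) (hy : y ∈ U) : (G y).det ≠ 0 := (P.posDef hy).det_pos.ne'

lemma contDiffAt_christoffel (P : IsParam X U G) (hy : y ∈ U) (k i j : Fin n) :
    ContDiffAt ℝ ∞ (christoffel G k i j) y := by
  unfold christoffel
  refine contDiffAt_const.mul (ContDiffAt.sum fun l _ => ?_)
  refine (ContDiffAt.matrix_inv (P.contDiffAt_gram hy) (P.det_ne_zero hy) k l).mul ?_
  exact ((ContDiffAt.pderiv (P.contDiffAt_gram hy _ _) _).add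
    (ContDiffAt.pderiv (P.contDiffAt_gram hy _ _) _)).sub
    (ContDiffAt.pderiv (P.contDiffAt_gram hy _ _) _)

lemma pderiv_gram (P : IsParam X U G) (hy : y ∈ U) (i j k : Fin n) :
    pderiv k (fun z => G z i j) y = inner ℝ (dirDeriv i X y) (dirDeriv k (dirDeriv j X) y)
      + inner ℝ (dirDeriv k (dirDeriv i X) y) (dirDeriv j X y) := by
  rw [pderiv_eq_dirDeriv, dirDeriv_congr P.isOpen hy fun z hz => P.gram z hz i j]
  exact dirDeriv_inner (ContDiffAt.differentiableAt_top ((P.contDiffAt y hy).dirDeriv i))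
    (ContDiffAt.differentiableAt_top ((P.contDiffAt y hy).dirDeriv j)) k

/-- The Christoffel symbols are the components of the tangential part of `∂ⱼ∂ᵢ X`. -/
lemma sum_gram_mul_christoffel (P : IsParam X U G) (hy : y ∈ U) (i j l : Fin n) :
    ∑ k, G y l k * christoffel G k i j y
      = inner ℝ (dirDeriv j (dirDeriv i X) y) (dirDeriv l X y) := by
  -- After the product rule and symmetry of second derivatives, the three metric derivatives leave
  -- twice one inner product, which absorbs the factor `1 / 2`.
  have h1 : (fun k => christoffel G k i j y) = (G y)⁻¹.mulVec
      (fun l => inner ℝ (dirDeriv j (dirDeriv i X) y) (dirDeriv l X y)) := by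
    ext k
    simp only [christoffel, Matrix.mulVec, dotProduct, Finset.mul_sum]
    refine Finset.sum_congr rfl fun l _ => ?_
    rw [P.pderiv_gram hy, P.pderiv_gram hy, P.pderiv_gram hy,
      dirDeriv_comm (P.contDiffAt y hy) i j, dirDeriv_comm (P.contDiffAt y hy) i l,
      dirDeriv_comm (P.contDiffAt y hy) j l, real_inner_comm (dirDeriv j X y)]
    ring
  have h2 : (G y).mulVec (fun k => christoffel G k i j y) l
      = inner ℝ (dirDeriv j (dirDeriv i X) y) (dirDeriv l X y) := by
    rw [h1, Matrix.mulVec_mulVec, Matrix.mul_nonsing_inv _ (P.det_ne_zero hy).isUnit,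
      Matrix.one_mulVec]
  exact h2

/-- The second fundamental form: the normal part of `∂ⱼ∂ᵢ X`. -/
lemma inner_normalPart (P : IsParam X U G) (hy : y ∈ U) (i j l : Fin n) :
    inner ℝ (dirDeriv j (dirDeriv i X) y - ∑ k, christoffel G k i j y • dirDeriv k X y)
      (dirDeriv l X y) = 0 := by
  rw [inner_sub_left, ← P.sum_gram_mul_christoffel hy, sum_inner, sub_eq_zero]
  refine Finset.sum_congr rfl fun k _ => ?_
  rw [P.gram y hy, real_inner_smul_left, real_inner_comm]
  ring

/-- Obtained by differentiating `sum_gram_mul_christoffel` in direction `p`. It isolates the third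
derivative of `X`, which cancels when the curvature is antisymmetrized. -/
lemma sum_gram_mul_deriv_christoffel (P : IsParam X U G) (hy : y ∈ U) (p i j l : Fin n) :
    ∑ k, G y l k * (pderiv p (christoffel G k i j) y
        + ∑ m, christoffel G m i j y * christoffel G k p m y)
      = inner ℝ (dirDeriv p (dirDeriv j (dirDeriv i X)) y) (dirDeriv l X y)
        + inner ℝ (dirDeriv j (dirDeriv i X) y - ∑ k, christoffel G k i j y • dirDeriv k X y)
            (dirDeriv p (dirDeriv l X) y) := by
  have hX := P.contDiffAt y hy
  have d1 := dirDeriv_congr P.isOpen hy (fun z hz => P.sum_gram_mul_christoffel hz i j l) p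
  rw [dirDeriv_inner (ContDiffAt.differentiableAt_top ((hX.dirDeriv i).dirDeriv j))
      (ContDiffAt.differentiableAt_top (hX.dirDeriv l)),
    dirDeriv_sum (fun k _ => (ContDiffAt.differentiableAt_top (P.contDiffAt_gram hy l k)).fun_mul
      (ContDiffAt.differentiableAt_top (P.contDiffAt_christoffel hy k i j)))] at d1
  have d2 (k : Fin n) := dirDeriv_mul (ContDiffAt.differentiableAt_top (P.contDiffAt_gram hy l k))
      (ContDiffAt.differentiableAt_top (P.contDiffAt_christoffel hy k i j)) p
  simp only [d2, ← pderiv_eq_dirDeriv, P.pderiv_gram hy] at d1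
  have d3 : ∑ k, G y l k * ∑ m, christoffel G m i j y * christoffel G k p m y
      = ∑ m, christoffel G m i j y *
        inner ℝ (dirDeriv p (dirDeriv m X) y) (dirDeriv l X y) := by
    simp_rw [dirDeriv_comm hX p, ← P.sum_gram_mul_christoffel hy, Finset.mul_sum]
    rw [Finset.sum_comm]
    refine Finset.sum_congr rfl fun m _ => Finset.sum_congr rfl fun k _ => ?_
    ring
  simp only [mul_add, Finset.sum_add_distrib, d3, inner_sub_left, sum_inner,
    real_inner_smul_left] at d1 ⊢
  simp only [fun x => real_inner_comm (dirDeriv p (dirDeriv x X) y) (dirDeriv l X y),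
    fun x => real_inner_comm (dirDeriv x X y) (dirDeriv p (dirDeriv l X) y)] at d1
  linarith

/-- The **Gauss equation**. -/
lemma sum_gram_mul_riemannCoord (P : IsParam X U G) (hy : y ∈ U) (i j k q : Fin n) :
    ∑ l, G y q l * riemannCoord G i j k l y
      = inner ℝ (dirDeriv k (dirDeriv i X) y - ∑ m, christoffel G m i k y • dirDeriv m X y)
            (dirDeriv j (dirDeriv q X) y)
        - inner ℝ (dirDeriv k (dirDeriv j X) y - ∑ m, christoffel G m j k y • dirDeriv m X y)
            (dirDeriv i (dirDeriv q X) y) := by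
  have e1 := P.sum_gram_mul_deriv_christoffel hy j i k q
  have e2 := P.sum_gram_mul_deriv_christoffel hy i j k q
  have e3 : dirDeriv j (dirDeriv k (dirDeriv i X)) y
      = dirDeriv i (dirDeriv k (dirDeriv j X)) y := by
    have hX := P.contDiffAt
    rw [dirDeriv_congr P.isOpen hy (fun z hz => dirDeriv_comm (hX z hz) k i) j,
      dirDeriv_congr P.isOpen hy (fun z hz => dirDeriv_comm (hX z hz) k j) i,
      dirDeriv_comm ((hX y hy).dirDeriv k) j i]
  have e4 : ∑ l, G y q l * riemannCoord G i j k l y =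
      ∑ l, G y q l * (pderiv j (christoffel G l i k) y
        + ∑ m, christoffel G m i k y * christoffel G l j m y)
      - ∑ l, G y q l * (pderiv i (christoffel G l j k) y
        + ∑ m, christoffel G m j k y * christoffel G l i m y) := by
    rw [← Finset.sum_sub_distrib]
    refine Finset.sum_congr rfl fun l _ => ?_
    rw [riemannCoord, Finset.sum_sub_distrib]
    ring
  rw [e4, e1, e2, e3]
  ring

/-- The Ricci tensor of a hypersurface with unit normal `ν` and second fundamental form `h`. -/
lemma ricciCoord_eq (P : IsParam X U G) (hy : y ∈ U) {ν : V} {h : Matrix (Fin n) (Fin n) ℝ}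
    (hν : ∀ i, inner ℝ ν (dirDeriv i X y) = 0)
    (hh : ∀ i j, h i j = inner ℝ ν (dirDeriv j (dirDeriv i X) y))
    (hspan : ∀ v : V, (∀ i, inner ℝ v (dirDeriv i X y) = 0) → v = inner ℝ ν v • ν)
    (i j : Fin n) :
    ricciCoord G i j y = (((G y)⁻¹ * h).trace • h - h * (G y)⁻¹ * h) i j := by
  -- In codimension one the normal part of a second derivative is a multiple of `ν`.
  have hII (i j : Fin n) :
      dirDeriv j (dirDeriv i X) y - ∑ m, christoffel G m i j y • dirDeriv m X y = h i j • ν := by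
    rw [hspan _ (P.inner_normalPart hy i j), inner_sub_right, inner_sum, hh]
    simp [real_inner_smul_right, hν]
  have hsymm (i j : Fin n) : h i j = h j i := by
    rw [hh, hh, dirDeriv_comm (P.contDiffAt y hy)]
  have gauss (i j k q : Fin n) : ∑ l, G y q l * riemannCoord G i j k l y
      = h i k * h q j - h j k * h q i := by
    rw [P.sum_gram_mul_riemannCoord hy, hII, hII, real_inner_smul_left, real_inner_smul_left,
      ← hh, ← hh]
  have inv (i j k l : Fin n) : riemannCoord G i j k l y
      = ∑ q, (G y)⁻¹ l q * (h i k * h q j - h j k * h q i) := by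
    have e : (G y).mulVec (fun l => riemannCoord G i j k l y)
        = fun q => h i k * h q j - h j k * h q i := funext fun q => gauss i j k q
    have e' := congrArg ((G y)⁻¹.mulVec) e
    rw [Matrix.mulVec_mulVec, Matrix.nonsing_inv_mul _ (P.det_ne_zero hy).isUnit,
      Matrix.one_mulVec] at e'
    exact congrFun e' l
  simp only [ricciCoord, inv, mul_sub, Finset.sum_sub_distrib, Matrix.sub_apply, Matrix.smul_apply,
    Matrix.trace, Matrix.diag, Matrix.mul_apply, smul_eq_mul, Finset.sum_mul]
  congr 1
  · refine Finset.sum_congr rfl fun p _ => Finset.sum_congr rfl fun q _ => ?_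
    ring
  · refine Finset.sum_congr rfl fun p _ => Finset.sum_congr rfl fun q _ => ?_
    have e : (G y)⁻¹ p q = (G y)⁻¹ q p := by
      have := (P.posDef hy).isHermitian.inv.apply p q
      simpa using this.symm
    rw [e, hsymm i q]
    ring

end IsParam

end Gauss

/-! ### The algebraic step from the Einstein condition to umbilicity. -/

section LinearAlgebra

open scoped MatrixOrder

variable {n : ℕ}

/-- Numbers `lᵢ` with `H lᵢ - lᵢ² = n - 1`, where `H = ∑ lᵢ`, are all equal to `1` or all equal
to `-1`. -/
lemma eq_one_or_neg_one_of_sum_mul_sub_sq (hn : 3 ≤ n) (l : Fin n → ℝ)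
    (h : ∀ i, (∑ k, l k) * l i - l i ^ 2 = (n : ℝ) - 1) :
    ∃ s : ℝ, s ^ 2 = 1 ∧ ∀ i, l i = s := by
  have hn' : (3 : ℝ) ≤ n := by exact_mod_cast hn
  set H := ∑ k, l k with hH
  have hpos (k : Fin n) : 0 < H * l k := by nlinarith [h k, sq_nonneg (l k)]
  have heq (i j : Fin n) : l i = l j := by
    by_contra hne
    have hsum : l i + l j = H := by
      have : (l i - l j) * (l i + l j - H) = 0 := by linarith [h i, h j]
      rcases mul_eq_zero.1 this with h0 | h0
      · exact absurd (sub_eq_zero.1 h0) hne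
      · linarith
    have hij : i ≠ j := fun e => hne (by rw [e])
    have hrest : ∑ k ∈ Finset.univ \ {i, j}, l k = 0 := by
      have := Finset.sum_sdiff (f := l) (Finset.subset_univ {i, j})
      rw [Finset.sum_pair hij] at this
      linarith
    -- This is where `n ≥ 3` is needed: a third index must remain.
    have hne : (Finset.univ \ {i, j} : Finset (Fin n)).Nonempty := by
      rw [← Finset.card_pos, Finset.card_sdiff_of_subset (Finset.subset_univ _),
        Finset.card_pair hij, Finset.card_univ, Fintype.card_fin]
      omega
    have := Finset.sum_pos (fun k _ => hpos k) hne
    rw [← Finset.mul_sum, hrest] at this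
    simp at this
  let i₀ : Fin n := ⟨0, by omega⟩
  refine ⟨l i₀, ?_, fun i => heq i i₀⟩
  have hsum : H = n * l i₀ := by
    rw [hH, Finset.sum_congr rfl fun k _ => heq k i₀]
    simp
  have := h i₀
  rw [hsum] at this
  have h2 : ((n : ℝ) - 1) * (l i₀ ^ 2 - 1) = 0 := by linarith
  rcases mul_eq_zero.1 h2 with h0 | h0 <;> linarith

/-- Evaluating the identity on an eigenvector basis reduces it to the scalar statement about
eigenvalues. -/
lemma eq_smul_one_of_trace_smul_sub_sq (hn : 3 ≤ n) {K : Matrix (Fin n) (Fin n) ℝ}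
    (hK : K.IsHermitian) (h : K.trace • K - K * K = ((n : ℝ) - 1) • 1) :
    ∃ s : ℝ, s ^ 2 = 1 ∧ K = s • 1 := by
  have htr : K.trace = ∑ k, hK.eigenvalues k := by simpa using hK.trace_eq_sum_eigenvalues
  obtain ⟨s, hs, hl⟩ := eq_one_or_neg_one_of_sum_mul_sub_sq hn hK.eigenvalues fun i => by
    have hv := hK.mulVec_eigenvectorBasis i
    set v := hK.eigenvectorBasis i with hvdef
    have hv0 : v.ofLp ≠ 0 := by
      intro h0
      have : v = 0 := by ext k; exact congrFun h0 k
      exact hK.eigenvectorBasis.toBasis.ne_zero i (by simpa [hvdef] using this)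
    have e := congrArg (fun A => A.mulVec v.ofLp) h
    simp only [Matrix.sub_mulVec, Matrix.smul_mulVec, ← Matrix.mulVec_mulVec, hv,
      Matrix.mulVec_smul, Matrix.one_mulVec, htr] at e
    rw [smul_smul, smul_smul, ← sub_smul, ← sub_eq_zero, ← sub_smul] at e
    have := (smul_eq_zero.1 e).resolve_right hv0
    linarith
  refine ⟨s, hs, ?_⟩
  have hsp := hK.spectral_theorem
  have : hK.eigenvalues = fun _ => s := funext hl
  rw [this] at hsp
  rw [hsp]
  have : Matrix.diagonal ((RCLike.ofReal : ℝ → ℝ) ∘ fun _ => s)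
      = s • (1 : Matrix (Fin n) (Fin n) ℝ) := by
    ext i j; simp [Matrix.diagonal, Matrix.one_apply]
  rw [this, map_smul, map_one]

/-- The algebraic form of the Einstein condition for a hypersurface forces umbilicity. -/
lemma eq_smul_of_trace_smul_sub (hn : 3 ≤ n) {G h : Matrix (Fin n) (Fin n) ℝ} (hG : G.PosDef)
    (hh : h.IsSymm) (hR : (G⁻¹ * h).trace • h - h * G⁻¹ * h = ((n : ℝ) - 1) • G) :
    ∃ s : ℝ, s ^ 2 = 1 ∧ h = s • G := by
  obtain ⟨B, hB, hGB⟩ : ∃ B : Matrix (Fin n) (Fin n) ℝ, IsUnit B.det ∧ G = B.transpose * B := by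
    obtain ⟨B, hB⟩ := CStarAlgebra.nonneg_iff_eq_star_mul_self.1 hG.posSemidef.nonneg
    rw [Matrix.star_eq_conjTranspose, Matrix.conjTranspose_eq_transpose_of_trivial] at hB
    refine ⟨B, isUnit_iff_ne_zero.2 fun h0 => hG.det_pos.ne' ?_, hB⟩
    rw [hB, Matrix.det_mul, h0, mul_zero]
  have hBt : IsUnit B.transpose.det := by rwa [Matrix.det_transpose]
  -- `G⁻¹ * h` need not be symmetric; its conjugate `K`, the shape operator in an orthonormal frame,
  -- is.
  obtain ⟨K, hK⟩ : ∃ K, K = B.transpose⁻¹ * h * B⁻¹ := ⟨_, rfl⟩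
  have hhK : h = B.transpose * K * B := by
    rw [hK]
    simp only [Matrix.mul_assoc, Matrix.nonsing_inv_mul _ hB, Matrix.mul_one]
    rw [← Matrix.mul_assoc, Matrix.mul_nonsing_inv _ hBt, Matrix.one_mul]
  have hGi : G⁻¹ = B⁻¹ * B.transpose⁻¹ := by rw [hGB, Matrix.mul_inv_rev]
  have hGh : G⁻¹ * h = B⁻¹ * K * B := by
    rw [hGi, hhK, Matrix.mul_assoc, Matrix.mul_assoc, Matrix.mul_assoc,
      ← Matrix.mul_assoc B.transpose⁻¹, Matrix.nonsing_inv_mul _ hBt, Matrix.one_mul]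
  have htr : (G⁻¹ * h).trace = K.trace := by
    rw [hGh, Matrix.trace_mul_comm, ← Matrix.mul_assoc, Matrix.mul_nonsing_inv _ hB, Matrix.one_mul]
  have hsymm : K.IsHermitian := by
    rw [Matrix.IsHermitian, Matrix.conjTranspose_eq_transpose_of_trivial, hK]
    simp only [Matrix.transpose_mul, Matrix.transpose_nonsing_inv, Matrix.transpose_transpose, hh.eq,
      Matrix.mul_assoc]
  have hKK : K.trace • K - K * K = ((n : ℝ) - 1) • 1 := by
    have e : B.transpose * (K.trace • K - K * K) * B
        = B.transpose * (((n : ℝ) - 1) • 1) * B := by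
      have e1 : h * G⁻¹ * h = B.transpose * (K * K) * B := by
        rw [Matrix.mul_assoc, hGh, hhK]
        simp only [Matrix.mul_assoc]
        rw [← Matrix.mul_assoc B B⁻¹, Matrix.mul_nonsing_inv _ hB, Matrix.one_mul]
      rw [htr, e1, hGB] at hR
      rw [Matrix.mul_sub, Matrix.sub_mul, Matrix.mul_smul, Matrix.smul_mul, ← hhK, hR]
      simp
    have c1 := Matrix.mul_left_injective_of_inv B B⁻¹ (Matrix.mul_nonsing_inv _ hB) e
    exact Matrix.mul_right_injective_of_inv _ _ (Matrix.nonsing_inv_mul _ hBt) c1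
  obtain ⟨s, hs, hKs⟩ := eq_smul_one_of_trace_smul_sub_sq hn hsymm hKK
  refine ⟨s, hs, ?_⟩
  rw [hhK, hKs, hGB]
  simp

end LinearAlgebra

/-! ### Unit normals to a hyperplane. -/

section Normal

variable {n : ℕ} {V : Type*} [NormedAddCommGroup V] [InnerProductSpace ℝ V]

lemma exists_unit_normal (hV : Module.finrank ℝ V = n + 1) (e : Fin n → V) :
    ∃ ν : V, ‖ν‖ = 1 ∧ ∀ i, inner ℝ ν (e i) = 0 := by
  have : FiniteDimensional ℝ V := Module.finite_of_finrank_pos (by omega)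
  have hW : Module.finrank ℝ (Submodule.span ℝ (Set.range e)) ≤ n := by
    simpa [Set.finrank] using finrank_range_le_card (R := ℝ) e
  have hsum := (Submodule.span ℝ (Set.range e)).finrank_add_finrank_orthogonal
  have : (Submodule.span ℝ (Set.range e))ᗮ ≠ ⊥ := by
    intro h0
    rw [h0, finrank_bot] at hsum
    omega
  obtain ⟨v, hv, hv0⟩ := Submodule.exists_mem_ne_zero_of_ne_bot this
  refine ⟨‖v‖⁻¹ • v, norm_smul_inv_norm hv0, fun i => ?_⟩
  rw [real_inner_smul_left, real_inner_comm,
    (Submodule.mem_orthogonal _ _).1 hv _ (Submodule.subset_span ⟨i, rfl⟩), mul_zero]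

lemma eq_inner_smul_unit_normal (hV : Module.finrank ℝ V = n + 1) {e : Fin n → V}
    (he : LinearIndependent ℝ e) {ν : V} (hν : ‖ν‖ = 1) (hνe : ∀ i, inner ℝ ν (e i) = 0)
    {v : V} (hv : ∀ i, inner ℝ v (e i) = 0) : v = (inner ℝ ν v : ℝ) • ν := by
  have : FiniteDimensional ℝ V := Module.finite_of_finrank_pos (by omega)
  set W := Submodule.span ℝ (Set.range e) with hWdef
  have hW : Module.finrank ℝ W = n := by
    simpa using finrank_span_eq_card he
  have hW1 : Module.finrank ℝ Wᗮ = 1 := by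
    have := W.finrank_add_finrank_orthogonal
    omega
  have mem {w : V} (hw : ∀ i, inner ℝ w (e i) = 0) : w ∈ Wᗮ := by
    rw [Submodule.mem_orthogonal', hWdef]
    intro u hu
    induction hu using Submodule.span_induction with
    | mem x hx => obtain ⟨i, rfl⟩ := hx; exact hw i
    | zero => exact inner_zero_right _
    | add x y _ _ hx hy => rw [inner_add_right, hx, hy, add_zero]
    | smul a x _ hx => rw [inner_smul_right, hx, mul_zero]
  have hν0 : (⟨ν, mem hνe⟩ : Wᗮ) ≠ 0 := by
    intro h0
    have : ν = 0 := congrArg Subtype.val h0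
    simp [this] at hν
  obtain ⟨c, hc⟩ := exists_smul_eq_of_finrank_eq_one hW1 hν0 ⟨v, mem hv⟩
  have hc' : c • ν = v := congrArg Subtype.val hc
  rw [← hc', real_inner_smul_right, real_inner_self_eq_norm_sq, hν]
  simp

end Normal

/-! ### Osculating unit spheres and the constancy of their centres. -/

section Umbilic

variable {n : ℕ} {V : Type*} [NormedAddCommGroup V] [InnerProductSpace ℝ V]
  {X : Eucl n → V} {U : Set (Eucl n)} {G : Eucl n → Matrix (Fin n) (Fin n) ℝ}

/-- The unit sphere centred at `c` is tangent to second order to the parametrized hypersurface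
`X` at the parameter `y`. -/
structure IsOsculatingCenter (X : Eucl n → V) (c : V) (y : Eucl n) : Prop where
  norm_eq : ‖X y - c‖ = 1
  inner_dirDeriv : ∀ i, inner ℝ (X y - c) (dirDeriv i X y) = 0
  inner_dirDeriv_dirDeriv : ∀ i j, inner ℝ (X y - c) (dirDeriv j (dirDeriv i X) y)
    = - inner ℝ (dirDeriv i X y) (dirDeriv j X y)

lemma IsParam.exists_isOsculatingCenter (P : IsParam X U G) (hV : Module.finrank ℝ V = n + 1)
    (hn : 3 ≤ n) {y : Eucl n} (hy : y ∈ U)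
    (hRic : ∀ i j, ricciCoord G i j y = ((n : ℝ) - 1) * G y i j) :
    ∃ c, IsOsculatingCenter X c y := by
  obtain ⟨ν, hν, hνX⟩ := exists_unit_normal hV fun i => dirDeriv i X y
  let h : Matrix (Fin n) (Fin n) ℝ := Matrix.of fun i j => inner ℝ ν (dirDeriv j (dirDeriv i X) y)
  have hsymm : h.IsSymm := by
    ext i j
    simp only [h, Matrix.transpose_apply, Matrix.of_apply]
    rw [dirDeriv_comm (P.contDiffAt y hy)]
  obtain ⟨s, hs, hsG⟩ := eq_smul_of_trace_smul_sub hn (P.posDef hy) hsymm <| by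
    ext i j
    rw [← P.ricciCoord_eq (h := h) hy hνX (fun _ _ => rfl) (fun v hv =>
      eq_inner_smul_unit_normal hV (P.linearIndependent y hy) hν hνX hv), hRic]
    rfl
  have hsG' (i j) : inner ℝ ν (dirDeriv j (dirDeriv i X) y) = s * G y i j :=
    congrFun (congrFun hsG i) j
  -- Replacing `ν` by `-ν` also flips `s`, so this point is independent of the choice of normal.
  refine ⟨X y + s • ν, ?_, fun i => ?_, fun i j => ?_⟩
  · have : |s| = 1 := by rw [← abs_one]; exact (sq_eq_sq_iff_abs_eq_abs _ _).1 (by simpa using hs)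
    simp [norm_smul, hν, this]
  · simp [real_inner_smul_left, hνX]
  · simp only [sub_add_cancel_left, inner_neg_left, real_inner_smul_left, hsG', ← P.gram y hy]
    linear_combination (- G y i j) * hs

/-- A field of osculating centres is locally constant. -/
lemma IsParam.hasFDerivAt_osculatingCenter (P : IsParam X U G)
    (hV : Module.finrank ℝ V = n + 1) (i₀ : Fin n) {c : Eucl n → V}
    (hc : ∀ y ∈ U, IsOsculatingCenter X (c y) y) {y : Eucl n} (hy : y ∈ U) :
    HasFDerivAt c (0 : Eucl n →L[ℝ] V) y := by
  have hX := P.contDiffAt y hy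
  have hdX (i : Fin n) : DifferentiableAt ℝ (dirDeriv i X) y := (hX.dirDeriv i).differentiableAt_top
  -- No regularity of `c` is assumed. The contact condition makes the normal part of `∂ᵢ₀∂ᵢ₀ X`
  -- equal to `-G i₀ i₀ • (X - c)`; solving for `X - c` gives a differentiable formula.
  let N : Eucl n → V := fun z => (G z i₀ i₀)⁻¹ •
    (∑ k, christoffel G k i₀ i₀ z • dirDeriv k X z - dirDeriv i₀ (dirDeriv i₀ X) z)
  have hN : ∀ z ∈ U, X z - c z = N z := by
    intro z hz
    have hcz := hc z hz
    have hG : G z i₀ i₀ ≠ 0 := (P.posDef hz).diag_pos.ne'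
    have e := eq_inner_smul_unit_normal hV (P.linearIndependent z hz) hcz.norm_eq
      hcz.inner_dirDeriv (P.inner_normalPart hz i₀ i₀)
    rw [inner_sub_right, hcz.inner_dirDeriv_dirDeriv, ← P.gram z hz, inner_sum] at e
    simp only [real_inner_smul_right, hcz.inner_dirDeriv, mul_zero, Finset.sum_const_zero,
      sub_zero] at e
    simp only [N]
    rw [← neg_sub (dirDeriv i₀ (dirDeriv i₀ X) z), e, neg_smul, neg_neg, smul_smul,
      inv_mul_cancel₀ hG, one_smul]
  have hNd : DifferentiableAt ℝ N y := by
    refine ((P.contDiffAt_gram hy i₀ i₀).differentiableAt_top.inv (P.posDef hy).diag_pos.ne').smul ?_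
    refine (DifferentiableAt.fun_sum fun k _ => ?_).sub
      ((hX.dirDeriv i₀).dirDeriv i₀).differentiableAt_top
    exact (P.contDiffAt_christoffel hy k i₀ i₀).differentiableAt_top.smul (hdX k)
  have hcN : ∀ z ∈ U, c z = X z - N z := fun z hz => by rw [← hN z hz, sub_sub_cancel]
  have hcy := hc y hy
  have hzero (j : Fin n) : dirDeriv j c y = 0 := by
    have e : dirDeriv j c y = dirDeriv j X y - dirDeriv j N y := by
      rw [dirDeriv_congr P.isOpen hy hcN, dirDeriv_sub hX.differentiableAt_top hNd]
    -- The tangential part vanishes: differentiate `⟨X - c, ∂ᵢ X⟩ = 0`.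
    have e1 (i : Fin n) : inner ℝ (dirDeriv j c y) (dirDeriv i X y) = 0 := by
      have h1 := dirDeriv_inner hNd (hdX i) j
      rw [dirDeriv_congr P.isOpen hy (Y := fun _ => (0 : ℝ)) (fun z hz => by
        rw [← hN z hz]; exact (hc z hz).inner_dirDeriv i), ← hN y hy,
        hcy.inner_dirDeriv_dirDeriv i j] at h1
      have h2 : dirDeriv j (fun _ : Eucl n => (0 : ℝ)) y = 0 := by simp [dirDeriv]
      rw [h2] at h1
      rw [e, inner_sub_left, real_inner_comm]
      linarith
    -- The normal part vanishes: differentiate `‖X - c‖² = 1`.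
    have e2 : inner ℝ (X y - c y) (dirDeriv j c y) = 0 := by
      have h1 := dirDeriv_inner hNd hNd j
      rw [dirDeriv_congr P.isOpen hy (Y := fun _ => (1 : ℝ)) (fun z hz => by
        rw [← hN z hz, real_inner_self_eq_norm_sq, (hc z hz).norm_eq, one_pow]), ← hN y hy,
        real_inner_comm (X y - c y) (dirDeriv j N y)] at h1
      have h2 : dirDeriv j (fun _ : Eucl n => (1 : ℝ)) y = 0 := by simp [dirDeriv]
      rw [h2] at h1
      rw [e, inner_sub_right, hcy.inner_dirDeriv]
      linarith
    rw [eq_inner_smul_unit_normal hV (P.linearIndependent y hy) hcy.norm_eq hcy.inner_dirDeriv e1,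
      e2, zero_smul]
  have hcd : DifferentiableAt ℝ c y :=
    (hX.differentiableAt_top.sub hNd).congr_of_eventuallyEq
      (Filter.eventually_of_mem (P.isOpen.mem_nhds hy) hcN)
  have : fderiv ℝ c y = 0 := by
    refine ContinuousLinearMap.coe_injective
      ((EuclideanSpace.basisFun (Fin n) ℝ).toBasis.ext fun j => ?_)
    simpa [dirDeriv] using hzero j
  rw [← this]
  exact hcd.hasFDerivAt

end Umbilic

/-! ### Coordinate invariance of second-order contact. -/

section Jets

variable {n : ℕ} {V : Type*} [NormedAddCommGroup V] [InnerProductSpace ℝ V]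

/-- The first two derivatives of `u` vanish at `y`. -/
def HasZeroJet (u : Eucl n → ℝ) (y : Eucl n) : Prop :=
  (∀ i, dirDeriv i u y = 0) ∧ ∀ i j, dirDeriv j (dirDeriv i u) y = 0

lemma HasZeroJet.congr {u v : Eucl n → ℝ} {y : Eucl n} (h : HasZeroJet u y)
    (huv : u =ᶠ[nhds y] v) : HasZeroJet v y := by
  obtain ⟨U, hU, hUo, hy⟩ := eventually_nhds_iff.1 huv
  have h1 (i : Fin n) : ∀ z ∈ U, dirDeriv i u z = dirDeriv i v z :=
    fun z hz => dirDeriv_congr hUo hz hU i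
  exact ⟨fun i => by rw [← h1 i y hy, h.1], fun i j => by
    rw [← dirDeriv_congr hUo hy (h1 i), h.2]⟩

lemma hasZeroJet_iff {u : Eucl n → ℝ} {y : Eucl n} (hu : ContDiffAt ℝ ∞ u y) :
    HasZeroJet u y ↔ fderiv ℝ u y = 0 ∧ fderiv ℝ (fderiv ℝ u) y = 0 := by
  have hb (L : Eucl n →L[ℝ] ℝ) : L = 0 ↔ ∀ i, L (EuclideanSpace.single i 1) = 0 := by
    refine ⟨fun h i => by rw [h]; rfl, fun h => ?_⟩
    refine ContinuousLinearMap.coe_injective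
      ((EuclideanSpace.basisFun (Fin n) ℝ).toBasis.ext fun j => ?_)
    simpa using h j
  have hd : DifferentiableAt ℝ (fderiv ℝ u) y :=
    (hu.fderiv_right (m := ∞) (by simp)).differentiableAt (by simp)
  have key (a b : Fin n) : dirDeriv a (dirDeriv b u) y
      = fderiv ℝ (fderiv ℝ u) y (EuclideanSpace.single a 1) (EuclideanSpace.single b 1) := by
    change fderiv ℝ (fun z => fderiv ℝ u z (EuclideanSpace.single b 1)) y _ = _
    rw [fderiv_clm_apply hd (differentiableAt_const _)]
    simp
  refine and_congr (hb _).symm ⟨fun h => ?_, fun h i j => ?_⟩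
  · refine ContinuousLinearMap.coe_injective
      ((EuclideanSpace.basisFun (Fin n) ℝ).toBasis.ext fun j => ?_)
    simpa using (hb _).2 fun i => by rw [← key, h]
  · rw [key, h]; rfl

/-- The second derivative of `u ∘ ψ` has one term with `D²u` and one with `Du`; both vanish at the
point. -/
lemma HasZeroJet.comp {u : Eucl n → ℝ} {ψ : Eucl n → Eucl n} {y : Eucl n}
    (hu : ContDiffAt ℝ ∞ u (ψ y)) (hψ : ContDiffAt ℝ ∞ ψ y) (h : HasZeroJet u (ψ y)) :
    HasZeroJet (u ∘ ψ) y := by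
  rw [hasZeroJet_iff hu] at h
  rw [hasZeroJet_iff (hu.comp y hψ)]
  have hu2 : DifferentiableAt ℝ (fderiv ℝ u) (ψ y) :=
    (hu.fderiv_right (m := ∞) (by simp)).differentiableAt (by simp)
  have hψ2 : DifferentiableAt ℝ (fderiv ℝ ψ) y :=
    (hψ.fderiv_right (m := ∞) (by simp)).differentiableAt (by simp)
  have hev : fderiv ℝ (u ∘ ψ) =ᶠ[nhds y] fun z => (fderiv ℝ u (ψ z)).comp (fderiv ℝ ψ z) := by
    have h1 : ∀ᶠ w in nhds (ψ y), DifferentiableAt ℝ u w :=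
      ((hu.of_le (m := 1) (by simp)).eventually (by simp)).mono
        fun w hw => hw.differentiableAt (by simp)
    have h2 : ∀ᶠ z in nhds y, DifferentiableAt ℝ ψ z :=
      ((hψ.of_le (m := 1) (by simp)).eventually (by simp)).mono
        fun w hw => hw.differentiableAt (by simp)
    filter_upwards [hψ.continuousAt.eventually h1, h2] with z hz1 hz2
    exact fderiv_comp z hz1 hz2
  refine ⟨by rw [hev.self_of_nhds]; simp [h.1], ?_⟩
  rw [hev.fderiv_eq]
  have h3 := (hu2.hasFDerivAt.comp y hψ.differentiableAt_top.hasFDerivAt).clm_comp hψ2.hasFDerivAt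
  refine (HasFDerivAt.fderiv h3).trans ?_
  simp [h.1, h.2]

/-- Rephrases contact through the scalar function `‖X - c‖²`, to which the chain rule for jets
applies. -/
lemma isOsculatingCenter_iff_hasZeroJet {X : Eucl n → V} {c : V} {y : Eucl n}
    (hX : ContDiffAt ℝ ∞ X y) :
    IsOsculatingCenter X c y ↔ ‖X y - c‖ = 1 ∧ HasZeroJet (fun z => ‖X z - c‖ ^ 2) y := by
  obtain ⟨U, hUX, hU, hy⟩ : ∃ U, (∀ z ∈ U, ContDiffAt ℝ 1 X z) ∧ IsOpen U ∧ y ∈ U :=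
    eventually_nhds_iff.1 ((hX.of_le (m := 1) (by simp)).eventually (by simp))
  have hsub (z) (i : Fin n) : dirDeriv i (fun z => X z - c) z = dirDeriv i X z := by
    simp only [dirDeriv, fderiv_sub_const]
  have h1 (i : Fin n) : ∀ z ∈ U, dirDeriv i (fun z => ‖X z - c‖ ^ 2) z
      = 2 * inner ℝ (X z - c) (dirDeriv i X z) := by
    intro z hz
    have hd : DifferentiableAt ℝ (fun z => X z - c) z :=
      ((hUX z hz).differentiableAt (by simp)).sub_const c
    simp_rw [← real_inner_self_eq_norm_sq]
    rw [dirDeriv_inner hd hd, hsub, real_inner_comm (X z - c)]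
    ring
  have h2 (i j : Fin n) : dirDeriv j (dirDeriv i (fun z => ‖X z - c‖ ^ 2)) y
      = 2 * (inner ℝ (X y - c) (dirDeriv j (dirDeriv i X) y)
        + inner ℝ (dirDeriv i X y) (dirDeriv j X y)) := by
    have hd : DifferentiableAt ℝ (fun z => X z - c) y := hX.differentiableAt_top.sub_const c
    have hd2 := (hX.dirDeriv i).differentiableAt_top
    rw [dirDeriv_congr hU hy (h1 i), dirDeriv_mul (differentiableAt_const _) (hd.inner ℝ hd2),
      dirDeriv_inner hd hd2, hsub, real_inner_comm (dirDeriv j X y)]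
    simp [dirDeriv]
  constructor
  · rintro ⟨a, b, d⟩
    refine ⟨a, fun i => by rw [h1 i y hy, b, mul_zero], fun i j => by rw [h2, d]; ring⟩
  · rintro ⟨a, b, d⟩
    refine ⟨a, fun i => ?_, fun i j => ?_⟩
    · have := b i
      rw [h1 i y hy] at this
      linarith
    · have := d i j
      rw [h2] at this
      linarith

end Jets

/-! ### Charts of an immersed manifold as parametrizations. -/

section Immersion

variable {n d : ℕ} {M : Type*} [TopologicalSpace M] [ChartedSpace (Eucl n) M]
  {f : M → Eucl d}

/-- In adapted charts the immersion is `u ↦ (u, 0)`, so projecting to the first factor gives a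
differentiable local left inverse. -/
lemma injective_mfderiv_of_isImmersion (hf : Manifold.IsImmersion (𝓡 n) (𝓡 d) ∞ f) (x : M) :
    Function.Injective (mfderiv (𝓡 n) (𝓡 d) f x) := by
  have h := hf.isImmersionAt x
  let φ := h.domChart
  let ψ := h.codChart
  let q : Eucl d → Eucl n := fun w => (h.equiv.symm w).1
  let g : Eucl d → M := φ.symm ∘ q ∘ ψ
  have hgf : ∀ z ∈ φ.source, g (f z) = z := by
    intro z hz
    have e := h.writtenInCharts (show φ z ∈ (h.domChart.extend (𝓡 n)).target by
      simpa using φ.map_source hz)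
    have e' : ψ (f z) = h.equiv (φ z, 0) := by
      simpa [φ, ψ, φ.left_inv hz] using e
    simp only [g, q, Function.comp_apply, e', ContinuousLinearEquiv.symm_apply_apply]
    exact φ.left_inv hz
  have hx : x ∈ φ.source := h.mem_domChart_source
  have hqx : q (ψ (f x)) = φ x := by
    have e := h.writtenInCharts (show φ x ∈ (h.domChart.extend (𝓡 n)).target by
      simpa using φ.map_source hx)
    have e' : ψ (f x) = h.equiv (φ x, 0) := by
      simpa [φ, ψ, φ.left_inv hx] using e
    simp only [q, e', ContinuousLinearEquiv.symm_apply_apply]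
  have hψ : MDifferentiableAt (𝓡 d) (𝓡 d) ψ (f x) :=
    (contMDiffAt_of_mem_maximalAtlas h.codChart_mem_maximalAtlas
      h.mem_codChart_source).mdifferentiableAt (by simp)
  have hq : MDifferentiableAt (𝓡 d) (𝓡 n) q (ψ (f x)) := by
    have : Differentiable ℝ q := by fun_prop
    exact (this _).mdifferentiableAt
  have hφ : MDifferentiableAt (𝓡 n) (𝓡 n) φ.symm (q (ψ (f x))) := by
    rw [hqx]
    exact (contMDiffAt_symm_of_mem_maximalAtlas h.domChart_mem_maximalAtlas
      (φ.map_source hx)).mdifferentiableAt (by simp)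
  have hg : MDifferentiableAt (𝓡 d) (𝓡 n) g (f x) := hφ.comp (f x) (hq.comp (f x) hψ)
  have hfx : MDifferentiableAt (𝓡 n) (𝓡 d) f x := (hf.contMDiff x).mdifferentiableAt (by simp)
  have e1 := mfderiv_comp x hg hfx
  have e2 : mfderiv (𝓡 n) (𝓡 n) (g ∘ f) x = mfderiv (𝓡 n) (𝓡 n) id x := by
    refine Filter.EventuallyEq.mfderiv_eq ?_
    exact Filter.eventually_of_mem (φ.open_source.mem_nhds hx) hgf
  rw [e2, mfderiv_id] at e1
  intro v w hvw
  have hv := DFunLike.congr_fun e1 v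
  have hw := DFunLike.congr_fun e1 w
  simp only [ContinuousLinearMap.coe_comp, Function.comp_apply]
    at hv hw
  rw [hvw] at hv
  exact hv.trans hw.symm

lemma inducedMetric_apply (f : M → Eucl d) (x : M) (v w : TangentSpace (𝓡 n) x) :
    inducedMetric f x v w
      = inner ℝ (show Eucl d from mfderiv (𝓡 n) (𝓡 d) f x v)
        (show Eucl d from mfderiv (𝓡 n) (𝓡 d) f x w) := rfl

variable [IsManifold (𝓡 n) ∞ M]

lemma contMDiffAt_symm_extChartAt {x : M} {y : Eucl n} (hy : y ∈ (extChartAt (𝓡 n) x).target) :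
    ContMDiffAt (𝓡 n) (𝓡 n) ∞ (extChartAt (𝓡 n) x).symm y :=
  (contMDiffOn_extChartAt_symm x).contMDiffAt ((isOpen_extChartAt_target x).mem_nhds hy)

lemma injective_mfderiv_symm_extChartAt {x : M} {y : Eucl n}
    (hy : y ∈ (extChartAt (𝓡 n) x).target) :
    Function.Injective (mfderiv (𝓡 n) (𝓡 n) (extChartAt (𝓡 n) x).symm y) := by
  have h := mfderiv_extChartAt_comp_mfderivWithin_extChartAt_symm (I := 𝓡 n) hy
  rw [ModelWithCorners.range_eq_univ, mfderivWithin_univ] at h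
  intro v w hvw
  have hv := DFunLike.congr_fun h v
  have hw := DFunLike.congr_fun h w
  simp only [ContinuousLinearMap.coe_comp, Function.comp_apply]
    at hv hw
  rw [hvw] at hv
  exact hv.symm.trans hw

lemma fderiv_comp_symm_extChartAt (hf : ContMDiff (𝓡 n) (𝓡 d) ∞ f) {x : M} {y : Eucl n}
    (hy : y ∈ (extChartAt (𝓡 n) x).target) :
    fderiv ℝ (f ∘ (extChartAt (𝓡 n) x).symm) y
      = (mfderiv (𝓡 n) (𝓡 d) f ((extChartAt (𝓡 n) x).symm y)).comp
        (mfderiv (𝓡 n) (𝓡 n) (extChartAt (𝓡 n) x).symm y) := by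
  rw [← mfderiv_eq_fderiv]
  exact mfderiv_comp y ((hf _).mdifferentiableAt (by simp))
    ((contMDiffAt_symm_extChartAt hy).mdifferentiableAt (by simp))

/-- The inverse of a chart gives a parametrization of an immersed manifold. -/
lemma isParam_comp_symm_extChartAt (hf : Manifold.IsImmersion (𝓡 n) (𝓡 d) ∞ f) (x : M) :
    IsParam (f ∘ (extChartAt (𝓡 n) x).symm) (extChartAt (𝓡 n) x).target
      (metricCoord (inducedMetric f) x) where
  isOpen := isOpen_extChartAt_target x
  contDiffAt z hz :=
    ((hf.contMDiff _).comp z (contMDiffAt_symm_extChartAt hz)).contDiffAt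
  gram z hz i j := by
    simp only [dirDeriv, fderiv_comp_symm_extChartAt hf.contMDiff hz]
    rfl
  linearIndependent z hz := by
    have hinj : Function.Injective (fderiv ℝ (f ∘ (extChartAt (𝓡 n) x).symm) z) := by
      rw [fderiv_comp_symm_extChartAt hf.contMDiff hz]
      exact (injective_mfderiv_of_isImmersion hf _).comp (injective_mfderiv_symm_extChartAt hz)
    have hb := (EuclideanSpace.basisFun (Fin n) ℝ).toBasis.linearIndependent.map'
      (fderiv ℝ (f ∘ (extChartAt (𝓡 n) x).symm) z).toLinearMap (LinearMap.ker_eq_bot.2 hinj)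
    have e : (fun i => dirDeriv i (f ∘ (extChartAt (𝓡 n) x).symm) z)
        = (fderiv ℝ (f ∘ (extChartAt (𝓡 n) x).symm) z).toLinearMap ∘
          (EuclideanSpace.basisFun (Fin n) ℝ).toBasis := by
      ext1 i
      simp [dirDeriv]
    rw [e]
    exact hb

lemma ricciCoord_of_ricci_eq_smul {x : M} {r : ℝ}
    (hRic : ∀ v w : TangentSpace (𝓡 n) x,
      ricci (inducedMetric f) x v w = r * inducedMetric f x v w) (i j : Fin n) :
    ricciCoord (metricCoord (inducedMetric f) x) i j (extChartAt (𝓡 n) x x)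
      = r * metricCoord (inducedMetric f) x (extChartAt (𝓡 n) x x) i j := by
  have hx : extChartAt (𝓡 n) x x ∈ (extChartAt (𝓡 n) x).target := mem_extChartAt_target x
  have h := mfderiv_extChartAt_comp_mfderivWithin_extChartAt_symm' (I := 𝓡 n)
    (mem_extChartAt_source (I := 𝓡 n) x)
  rw [ModelWithCorners.range_eq_univ, mfderivWithin_univ] at h
  let b (i : Fin n) : Eucl n :=
    mfderiv (𝓡 n) (𝓡 n) (extChartAt (𝓡 n) x).symm (extChartAt (𝓡 n) x x)
      (EuclideanSpace.single i (1 : ℝ))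
  have hb (i : Fin n) : (mfderiv (𝓡 n) (𝓡 n) (extChartAt (𝓡 n) x) x (b i) : Eucl n)
      = EuclideanSpace.single i 1 := DFunLike.congr_fun h (EuclideanSpace.single i (1 : ℝ) : Eucl n)
  have key := hRic (b i) (b j)
  -- The chart sends `x` there and back only up to a propositional equality, so the base point of
  -- the tangent space has to be transported.
  have hmet : ∀ z : M, z = x → (inducedMetric f z (b i) (b j) : ℝ)
      = inducedMetric f x (b i) (b j) := by
    rintro _ rfl; rfl
  have e : metricCoord (inducedMetric f) x (extChartAt (𝓡 n) x x) i j
      = inducedMetric f x (b i) (b j) := hmet _ (extChartAt_to_inv x)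
  rw [e, ← key]
  simp only [ricci]
  rw [hb, hb]
  simp [PiLp.single_apply]

end Immersion

/-! ### Local rigidity: the centre is locally constant on the manifold. -/

section LocalRigidity

variable {n : ℕ} {M : Type*} [TopologicalSpace M] [ChartedSpace (Eucl n) M]
  [IsManifold (𝓡 n) ∞ M] {f : M → Eucl (n + 1)}

/-- An osculating centre at `p`, found in one chart, is one in every chart. -/
lemma isOsculatingCenter_of_extChartAt (hf : Manifold.IsImmersion (𝓡 n) (𝓡 (n + 1)) ∞ f)
    {c : Eucl (n + 1)} {x p : M} {y : Eucl n} (hy : y ∈ (extChartAt (𝓡 n) x).target)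
    (hp : p = (extChartAt (𝓡 n) x).symm y)
    (h : IsOsculatingCenter (f ∘ (extChartAt (𝓡 n) p).symm) c (extChartAt (𝓡 n) p p)) :
    IsOsculatingCenter (f ∘ (extChartAt (𝓡 n) x).symm) c y := by
  have Pp := isParam_comp_symm_extChartAt hf p
  have Px := isParam_comp_symm_extChartAt hf x
  have hpt : extChartAt (𝓡 n) p p ∈ (extChartAt (𝓡 n) p).target := mem_extChartAt_target p
  rw [isOsculatingCenter_iff_hasZeroJet (Pp.contDiffAt _ hpt)] at h
  rw [isOsculatingCenter_iff_hasZeroJet (Px.contDiffAt _ hy)]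
  obtain ⟨h1, h2⟩ := h
  refine ⟨?_, ?_⟩
  · rwa [Function.comp_apply, extChartAt_to_inv, hp] at h1
  let ψ : Eucl n → Eucl n := extChartAt (𝓡 n) p ∘ (extChartAt (𝓡 n) x).symm
  have hψy : ψ y = extChartAt (𝓡 n) p p := by simp only [ψ, Function.comp_apply, ← hp]
  have hψ : ContDiffAt ℝ ∞ ψ y := by
    have h0 : ContMDiffAt (𝓡 n) (𝓡 n) ∞ (extChartAt (𝓡 n) p) ((extChartAt (𝓡 n) x).symm y) := by
      rw [← hp]; exact contMDiffAt_extChartAt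
    exact (h0.comp y (contMDiffAt_symm_extChartAt hy)).contDiffAt
  have hu : ContDiffAt ℝ ∞ (fun z => ‖(f ∘ (extChartAt (𝓡 n) p).symm) z - c‖ ^ 2) (ψ y) := by
    rw [hψy]
    exact ((Pp.contDiffAt _ hpt).sub contDiffAt_const).norm_sq ℝ
  rw [← hψy] at h2
  refine (HasZeroJet.comp hu hψ h2).congr ?_
  have hnear : ∀ᶠ z in nhds y, (extChartAt (𝓡 n) x).symm z ∈ (extChartAt (𝓡 n) p).source := by
    refine (contMDiffAt_symm_extChartAt hy).continuousAt.eventually ?_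
    rw [← hp]
    exact extChartAt_source_mem_nhds p
  filter_upwards [hnear] with z hz
  simp only [ψ, Function.comp_apply, (extChartAt (𝓡 n) p).left_inv hz]

/-- A hypersurface with `Ric = (n - 1) g` lies locally in unit spheres. -/
theorem exists_isLocallyConstant_norm_sub_eq_one (hn : 3 ≤ n)
    (hf : Manifold.IsImmersion (𝓡 n) (𝓡 (n + 1)) ∞ f)
    (hRic : ∀ (x : M) (v w : TangentSpace (𝓡 n) x),
      ricci (inducedMetric f) x v w = ((n : ℝ) - 1) * inducedMetric f x v w) :
    ∃ c : M → Eucl (n + 1), IsLocallyConstant c ∧ ∀ x, ‖f x - c x‖ = 1 := by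
  have hV : Module.finrank ℝ (Eucl (n + 1)) = n + 1 := finrank_euclideanSpace_fin
  have hex (x : M) : ∃ c, IsOsculatingCenter (f ∘ (extChartAt (𝓡 n) x).symm) c
      (extChartAt (𝓡 n) x x) :=
    (isParam_comp_symm_extChartAt hf x).exists_isOsculatingCenter hV hn (mem_extChartAt_target x)
      (ricciCoord_of_ricci_eq_smul (hRic x))
  choose c hc using hex
  refine ⟨c, (IsLocallyConstant.iff_eventually_eq c).2 fun x => ?_, fun x => ?_⟩
  · have P := isParam_comp_symm_extChartAt hf x
    -- The Ricci condition yields the centre at each point in that point's own chart; all of them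
    -- are moved to the chart at `x` before differentiating.
    have hder : ∀ y ∈ (extChartAt (𝓡 n) x).target,
        HasFDerivAt (c ∘ (extChartAt (𝓡 n) x).symm) (0 : Eucl n →L[ℝ] Eucl (n + 1)) y :=
      fun y hy => P.hasFDerivAt_osculatingCenter hV ⟨0, by omega⟩
        (fun z hz => isOsculatingCenter_of_extChartAt hf hz rfl (hc _)) hy
    have hopen := P.isOpen.isOpen_inter_preimage_of_fderiv_eq_zero
      (fun y hy => (hder y hy).differentiableAt.differentiableWithinAt)
      (fun y hy => (hder y hy).fderiv) {c x}
    have hmem := hopen.mem_nhds (x := extChartAt (𝓡 n) x x) ⟨mem_extChartAt_target x, by simp⟩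
    filter_upwards [(continuousAt_extChartAt (I := 𝓡 n) x).preimage_mem_nhds hmem,
      extChartAt_source_mem_nhds (I := 𝓡 n) x] with p hp hps
    have h1 : c ((extChartAt (𝓡 n) x).symm (extChartAt (𝓡 n) x p)) = c x := hp.2
    rwa [(extChartAt (𝓡 n) x).left_inv hps] at h1
  · simpa using (hc x).norm_eq

end LocalRigidity

/-! ### Boundaries of convex open sets. -/

section Convex

variable {E : Type*} [NormedAddCommGroup E] [NormedSpace ℝ E]

/-- Polar coordinates exhibit it as a continuous image of a ray times the unit sphere. -/
lemma isPreconnected_compl_closedBall (hE : 1 < Module.rank ℝ E) (c : E) {r : ℝ} (hr : 0 ≤ r) :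
    IsPreconnected (Metric.closedBall c r)ᶜ := by
  have h : (Metric.closedBall c r)ᶜ
      = (fun p : ℝ × E => c + p.1 • p.2) '' (Set.Ioi r ×ˢ Metric.sphere 0 1) := by
    ext x
    simp only [Set.mem_compl_iff, Metric.mem_closedBall, not_le, dist_eq_norm, Set.mem_image,
      Set.mem_prod, Set.mem_Ioi, mem_sphere_zero_iff_norm, Prod.exists]
    constructor
    · intro hx
      have h0 : ‖x - c‖ ≠ 0 := (hr.trans_lt hx).ne'
      refine ⟨‖x - c‖, ‖x - c‖⁻¹ • (x - c), ⟨hx, ?_⟩, ?_⟩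
      · rw [norm_smul, norm_inv, norm_norm, inv_mul_cancel₀ h0]
      · rw [smul_smul, mul_inv_cancel₀ h0, one_smul, add_sub_cancel]
    · rintro ⟨t, u, ⟨ht, hu⟩, rfl⟩
      rw [add_sub_cancel_left, norm_smul, hu, mul_one]
      exact ht.trans_le (le_abs_self t)
  rw [h]
  exact (isPreconnected_Ioi.prod (isPreconnected_sphere hE 0 1)).image _
    (by fun_prop)

/-- Off the frontier, `u` and its exterior are disjoint open sets that cover `v`. -/
lemma _root_.IsPreconnected.subset_or_disjoint_of_disjoint_frontier {X : Type*} [TopologicalSpace X]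
    {u v : Set X} (hv : IsPreconnected v) (hu : IsOpen u) (huv : Disjoint v (frontier u)) :
    v ⊆ u ∨ Disjoint v u := by
  have hcov : v ⊆ u ∪ (closure u)ᶜ := by
    intro x hx
    by_cases hxu : x ∈ u
    · exact Or.inl hxu
    · refine Or.inr fun hxc => Set.disjoint_left.1 huv hx ?_
      rw [hu.frontier_eq]
      exact ⟨hxc, hxu⟩
  have hdisj : Disjoint u (closure u)ᶜ :=
    Set.disjoint_left.2 fun x hx hx' => hx' (subset_closure hx)
  rcases hv.subset_or_subset hu isClosed_closure.isOpen_compl hdisj hcov with h | h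
  · exact Or.inl h
  · exact Or.inr (hdisj.mono_right h).symm

/-- The exterior of the ball is connected and misses the frontier. If it lay in `Ω`, every point
would be a midpoint of two far points of `Ω`, so `Ω` would be the whole space and have empty
frontier. -/
lemma subset_closedBall_of_frontier_subset (hE : 1 < Module.rank ℝ E) {Ω : Set E} (hΩ : IsOpen Ω)
    (hconv : Convex ℝ Ω) (hne : (frontier Ω).Nonempty) {c : E} {r : ℝ} (hr : 0 ≤ r)
    (h : frontier Ω ⊆ Metric.closedBall c r) : Ω ⊆ Metric.closedBall c r := by
  rcases (isPreconnected_compl_closedBall hE c hr).subset_or_disjoint_of_disjoint_frontier hΩ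
    (Set.disjoint_left.2 fun x hx hx' => hx (h hx')) with hsub | hdisj
  · exfalso
    have : Nontrivial E := by
      rw [← rank_pos_iff_nontrivial (R := ℝ)]
      exact zero_lt_one.trans hE
    have huniv : Ω = Set.univ := by
      refine Set.eq_univ_of_forall fun z => ?_
      obtain ⟨w, hw⟩ := NormedSpace.exists_lt_norm ℝ E (r + ‖z - c‖)
      have h1 : z + w ∈ Ω := hsub (by
        simp only [Set.mem_compl_iff, Metric.mem_closedBall, not_le, dist_eq_norm]
        have := norm_sub_le (z + w - c) (z - c)
        rw [show z + w - c - (z - c) = w by abel] at this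
        linarith)
      have h2 : z - w ∈ Ω := hsub (by
        simp only [Set.mem_compl_iff, Metric.mem_closedBall, not_le, dist_eq_norm]
        have := norm_sub_le (z - c) (z - w - c)
        rw [show z - c - (z - w - c) = w by abel] at this
        linarith)
      have := hconv h1 h2 (a := 1 / 2) (b := 1 / 2) (by norm_num) (by norm_num) (by norm_num)
      rw [← smul_add, add_add_sub_cancel, ← two_smul ℝ z, smul_smul] at this
      simpa using this
    rw [huniv, frontier_univ] at hne
    exact Set.not_nonempty_empty hne
  · intro x hx
    by_contra hx'
    exact Set.disjoint_left.1 hdisj hx' hx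

lemma isPreconnected_frontier_of_convex (hE : 1 < Module.rank ℝ E) {Ω : Set E} (hΩ : IsOpen Ω)
    (hconv : Convex ℝ Ω) (hne : Ω.Nonempty) (hb : Bornology.IsBounded Ω) :
    IsPreconnected (frontier Ω) := by
  obtain ⟨e, -, -, he⟩ := exists_homeomorph_image_interior_closure_frontier_eq_unitBall hconv
    (by rwa [hΩ.interior_eq]) hb
  have : frontier Ω = e.symm '' Metric.sphere 0 1 := by
    rw [← he, ← Set.image_comp]
    simp
  rw [this]
  exact (isPreconnected_sphere hE 0 1).image _ e.symm.continuous.continuousOn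

/-- A bounded convex open set whose boundary lies in a sphere is the ball. -/
lemma frontier_eq_sphere_of_subset (hE : 1 < Module.rank ℝ E) {Ω : Set E} (hΩ : IsOpen Ω)
    (hconv : Convex ℝ Ω) (hne : (frontier Ω).Nonempty) {c : E} {r : ℝ} (hr : 0 < r)
    (h : frontier Ω ⊆ Metric.sphere c r) : frontier Ω = Metric.sphere c r := by
  have hsub := subset_closedBall_of_frontier_subset hE hΩ hconv hne hr.le
    (h.trans Metric.sphere_subset_closedBall)
  have hball : Ω ⊆ Metric.ball c r := by
    rw [← interior_closedBall c hr.ne']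
    exact interior_maximal hsub hΩ
  have hΩne : Ω.Nonempty := by
    by_contra h0
    rw [Set.not_nonempty_iff_eq_empty.1 h0, frontier_empty] at hne
    exact Set.not_nonempty_empty hne
  -- The open ball is connected and misses the frontier, so it lies in `Ω` or avoids it; the latter
  -- would make `Ω` empty.
  rcases (convex_ball c r).isPreconnected.subset_or_disjoint_of_disjoint_frontier hΩ
    (Set.disjoint_left.2 fun x hx hx' => (Metric.mem_ball.1 hx).ne (h hx')) with h1 | h1
  · rw [hball.antisymm h1, frontier_ball c hr.ne']
  · obtain ⟨x, hx⟩ := hΩne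
    exact absurd hx (Set.disjoint_left.1 h1 (hball hx))

end Convex

/-! ### Translation of a unit sphere to the origin. -/

section Translation

variable {n : ℕ}

lemma mfderiv_sub_const_eq {d : ℕ} {M : Type*} [TopologicalSpace M] [ChartedSpace (Eucl n) M]
    {f : M → Eucl d} {x : M} (hf : MDifferentiableAt (𝓡 n) (𝓡 d) f x) (c : Eucl d)
    (v : TangentSpace (𝓡 n) x) :
    (show Eucl d from mfderiv (𝓡 n) (𝓡 d) (fun z => f z - c) x v)
      = (show Eucl d from mfderiv (𝓡 n) (𝓡 d) f x v) := by
  have h : HasMFDerivAt (𝓡 d) (𝓡 d) (fun z : Eucl d => z - c) (f x)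
      (ContinuousLinearMap.id ℝ (Eucl d)) :=
    ((hasFDerivAt_id (f x)).sub_const c).hasMFDerivAt
  have h2 := (h.comp x hf.hasMFDerivAt).mfderiv
  exact DFunLike.congr_fun h2 v

/-- The translation of a unit sphere to the origin is an isometry. -/
theorem riemannianIsometric_unitSphere_of_eq_sphere {S : Set (Eucl (n + 1))}
    [ChartedSpace (Eucl n) S] [IsManifold (𝓡 n) ∞ S]
    (hS : Manifold.IsImmersion (𝓡 n) (𝓡 (n + 1)) ∞ (Subtype.val : S → Eucl (n + 1)))
    {c : Eucl (n + 1)} (hc : S = Metric.sphere c 1) :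
    RiemannianIsometric (n := n)
      (inducedMetric (Subtype.val : S → Eucl (n + 1)))
      (inducedMetric (Subtype.val : unitSphere n → Eucl (n + 1))) := by
  have := Fact.mk (finrank_euclideanSpace_fin (𝕜 := ℝ) (n := n + 1))
  have hmem (x : S) : (x : Eucl (n + 1)) - c ∈ unitSphere n := by
    have h : (x : Eucl (n + 1)) ∈ Metric.sphere c 1 := hc ▸ x.2
    simpa [mem_sphere_iff_norm] using h
  have hmem' (y : unitSphere n) : (y : Eucl (n + 1)) + c ∈ S := by
    rw [hc, mem_sphere_iff_norm, add_sub_cancel_right]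
    exact norm_eq_of_mem_sphere y
  have hsm : ContMDiff (𝓡 n) (𝓡 (n + 1)) ∞ fun x : S => (x : Eucl (n + 1)) - c :=
    hS.contMDiff.sub contMDiff_const
  have hF : ContMDiff (𝓡 n) (𝓡 n) ∞ (Set.codRestrict _ (unitSphere n) hmem) :=
    hsm.codRestrict_sphere hmem
  have hval : ContMDiff (𝓡 n) (𝓡 (n + 1)) ∞ (Subtype.val : unitSphere n → Eucl (n + 1)) :=
    contMDiff_coe_sphere
  have hinv : ContMDiff (𝓡 n) (𝓡 n) ∞ fun y : unitSphere n => (⟨y + c, hmem' y⟩ : S) := by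
    -- The smooth structure on `S` is an arbitrary one making the inclusion an immersion, so
    -- smoothness into `S` is tested in the ambient space, together with continuity.
    rw [ContMDiff.iff_comp_isImmersion hS]
    exact ⟨by fun_prop, hval.add contMDiff_const⟩
  let F : S ≃ₘ^∞⟮𝓡 n, 𝓡 n⟯ unitSphere n :=
    { toFun := Set.codRestrict _ (unitSphere n) hmem
      invFun := fun y => ⟨y + c, hmem' y⟩
      left_inv := fun x => Subtype.ext (sub_add_cancel _ _)
      right_inv := fun y => Subtype.ext (add_sub_cancel_right _ _)
      contMDiff_toFun := hF
      contMDiff_invFun := hinv }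
  refine ⟨F, fun x v w => ?_⟩
  have key (u : TangentSpace (𝓡 n) x) :
      (show Eucl (n + 1) from mfderiv (𝓡 n) (𝓡 (n + 1)) (Subtype.val : unitSphere n → Eucl (n + 1))
        (F x) (mfderiv (𝓡 n) (𝓡 n) F x u))
      = (show Eucl (n + 1) from mfderiv (𝓡 n) (𝓡 (n + 1)) (Subtype.val : S → Eucl (n + 1)) x u) := by
    rw [← mfderiv_sub_const_eq ((hS.contMDiff x).mdifferentiableAt (by simp)) c u]
    have h := mfderiv_comp x ((hval (F x)).mdifferentiableAt (by simp))
      ((hF x).mdifferentiableAt (by simp))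
    exact (DFunLike.congr_fun h u).symm
  rw [inducedMetric_apply, inducedMetric_apply, key, key]

end Translation

end HypersurfaceRigidity

/-! ### The global conclusion. -/

theorem mainTheorem7 (n : ℕ) (hn : 3 ≤ n) (S : Set (Eucl (n + 1)))
    [ChartedSpace (Eucl n) S] [IsManifold (𝓡 n) ∞ S]
    (hS : Manifold.IsSmoothEmbedding (𝓡 n) (𝓡 (n + 1)) ∞ (Subtype.val : S → Eucl (n + 1)))
    (hne : S.Nonempty) (hclosed : IsCompact S) (hconv : IsConvexBoundary S)
    (hRic : ∀ (x : S) (v w : TangentSpace (𝓡 n) x),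
      ricci (n := n) (inducedMetric (Subtype.val : S → Eucl (n + 1))) x v w
        = ((n : ℝ) - 1) * inducedMetric (Subtype.val : S → Eucl (n + 1)) x v w) :
    RiemannianIsometric (n := n)
      (inducedMetric (Subtype.val : S → Eucl (n + 1)))
      (inducedMetric (Subtype.val : unitSphere n → Eucl (n + 1))) := by
  obtain ⟨c, hc, hc1⟩ := exists_isLocallyConstant_norm_sub_eq_one hn hS.isImmersion hRic
  obtain ⟨Ω, hΩ, hΩc, hfr⟩ := hconv
  have hrank : 1 < Module.rank ℝ (Eucl (n + 1)) := by
    rw [rank_eq_card_basis (EuclideanSpace.basisFun (Fin (n + 1)) ℝ).toBasis, Fintype.card_fin]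
    exact_mod_cast (by omega : 1 < n + 1)
  have hΩne : Ω.Nonempty := by
    by_contra h0
    rw [Set.not_nonempty_iff_eq_empty.1 h0, frontier_empty] at hfr
    exact hne.ne_empty hfr.symm
  have hΩb : Bornology.IsBounded Ω := by
    obtain ⟨r, hr⟩ := hclosed.isBounded.subset_closedBall 0
    exact Metric.isBounded_closedBall.subset <|
      subset_closedBall_of_frontier_subset hrank hΩ hΩc (by rwa [hfr]) (le_max_right r 0)
        (by rw [hfr]; exact hr.trans (Metric.closedBall_subset_closedBall (le_max_left r 0)))
  -- Connectedness turns the locally constant centre into a single point.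
  have hpre : IsPreconnected S := hfr ▸ isPreconnected_frontier_of_convex hrank hΩ hΩc hΩne hΩb
  have : PreconnectedSpace S := Subtype.preconnectedSpace hpre
  obtain ⟨p, hp⟩ := hne
  have hsub : frontier Ω ⊆ Metric.sphere (c ⟨p, hp⟩) 1 := by
    intro x hx
    rw [hfr] at hx
    rw [mem_sphere_iff_norm, hc.apply_eq_of_preconnectedSpace ⟨p, hp⟩ ⟨x, hx⟩]
    exact hc1 ⟨x, hx⟩
  exact riemannianIsometric_unitSphere_of_eq_sphere hS.isImmersion
    (hfr.symm.trans (frontier_eq_sphere_of_subset hrank hΩ hΩc (hfr ▸ ⟨p, hp⟩) one_pos hsub))
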